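/- Let $p\le m$ and consider the port-Hamiltonian system with states $x_1\in\mathbb R^m$, $x_2\in\mathbb R^p$, input $u\in\mathbb R^m$ and arbitrary constant disturbances $d_1\in\mathbb R^m$ (matched), $d_2\in\mathbb R^p$ (unmatched), $$\dot x_1=(J_1-R_1)\nabla_{x_1}H+J_{12}\nabla_{x_2}H+u-d_1,\qquad \dot x_2=-J_{12}^\top\nabla_{x_1}H+(J_2-R_2)\nabla_{x_2}H-d_2,$$ where $J_1=-J_1^\top$, $J_2=-J_2^\top$, $R_1=R_1^\top>0$, $R_2=R_2^\top\ge0$, the matrices depend smoothly on $(x_1,x_2)$, and $H:\mathbb R^{m+p}\to\mathbb R$ is smooth with a strict minimum at $(x_1^*,x_2^*)$. Close the loop with the controller $$u=(J_1-R_1)\nabla_{x_1}\big[H_c(E^\top x_1-\zeta)\big],\qquad \dot\zeta=E^\top J_{12}\nabla_{x_2}H,\qquad \zeta\in\mathbb R^p,$$ where $E\in\mathbb R^{m\times p}$ is constant of full rank and $H_c:\mathbb R^p\to\mathbb R$ is strictly convex and twice continuously differentiable with invertible (bijective) gradient map $\nabla H_c:\mathbb R^p\to\mathbb R^p$. Assume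 that (i) $J_{12}$ and $R_1$ have full rank; (ii) $\nabla_{x_1x_2}H=0$ identically; (iii) $H$ is strongly convex; (iv) $J_1$, $R_1$ and $J_{12}$ are constant, and $J_{12}^\top E$ is invertible; (v) there is a unique $\bar x_1\in\mathbb R^m$ with $$\nabla_{x_1}H(\bar x_1,x_2^*)=\{I-E(J_{12}^\top E)^{-1}J_{12}^\top\}(J_1-R_1)^{-1}d_1-E(J_{12}^\top E)^{-1}d_2 .$$ Put $H_{cl}(x_1,x_2,\zeta)=H(x_1,x_2)+H_c(E^\top x_1-\zeta)$. Then there is $\bar\zeta\in\mathbb R^p$ such that $(\bar x_1,x_2^*,\bar\zeta)$ is the unique point at which $$\nabla_{x_1}H_{cl}=(J_1-R_1)^{-1}d_1,\qquad \nabla_{x_2}H_{cl}=0,\qquad \nabla_\zeta H_{cl}=-(J_{12}^\top E)^{-1}\{J_{12}^\top(J_1-R_1)^{-1}d_1+d_2\},$$ and this point is a globally asymptotically stable equilibrium of the closed loop: it is an equilibrium, from every initial state there is a unique solution, defined for all $t\ge0$, the equilibrium is Lyapunov stable, and every solution converges to it as $t\to\infty$. -/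

import Mathlib

open scoped ContDiff Matrix

noncomputable section

/-- `ℝⁿ` with its Euclidean inner product. -/
abbrev Vec (n : ℕ) : Type := EuclideanSpace ℝ (Fin n)

/-- A matrix acting on Euclidean column vectors. -/
def matAct {m n : ℕ} (A : Matrix (Fin m) (Fin n) ℝ) (v : Vec n) : Vec m :=
  WithLp.toLp 2 (A *ᵥ v.ofLp)

/-! ### Partial gradients -/

/-- The gradient of `f (x₁, x₂)` with respect to `x₁`. -/
def gradFst {m p : ℕ} (f : Vec m × Vec p → ℝ) (x : Vec m × Vec p) : Vec m :=
  gradient (fun y : Vec m => f (y, x.2)) x.1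

/-- The gradient of `f (x₁, x₂)` with respect to `x₂`. -/
def gradSnd {m p : ℕ} (f : Vec m × Vec p → ℝ) (x : Vec m × Vec p) : Vec p :=
  gradient (fun y : Vec p => f (x.1, y)) x.2

/-! ### Asymptotic stability -/

/-- `γ` solves `ẇ = f(w)` on the set `s` of times, with one-sided derivatives at end points. -/
def SolvesOn {X : Type*} [NormedAddCommGroup X] [NormedSpace ℝ X]
    (f : X → X) (γ : ℝ → X) (s : Set ℝ) : Prop :=
  IsIntegralCurveOn γ (fun _ => f) s

/-- The point `e` is a globally asymptotically stable equilibrium of `ẇ = f(w)`. -/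
structure IsGloballyAsymptoticallyStable {X : Type*} [NormedAddCommGroup X] [NormedSpace ℝ X]
    (f : X → X) (e : X) : Prop where
  /-- `e` is an equilibrium. -/
  equilibrium : f e = 0
  /-- From every initial state there is a solution on `[0, ∞)`, and every other solution from
  that state, on whatever interval `[0, T)`, is a restriction of it. -/
  complete : ∀ w₀ : X, ∃ γ : ℝ → X, γ 0 = w₀ ∧ SolvesOn f γ (Set.Ici 0) ∧
    ∀ (T : ℝ) (η : ℝ → X), η 0 = w₀ → SolvesOn f η (Set.Ico 0 T) →
      Set.EqOn η γ (Set.Ico 0 T)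
  /-- Lyapunov stability. -/
  stable : ∀ ε > 0, ∃ δ > 0, ∀ γ : ℝ → X, SolvesOn f γ (Set.Ici 0) →
    ‖γ 0 - e‖ < δ → ∀ t ≥ 0, ‖γ t - e‖ < ε
  /-- Global attractivity. -/
  attractive : ∀ γ : ℝ → X, SolvesOn f γ (Set.Ici 0) →
    Filter.Tendsto γ Filter.atTop (nhds e)

/-! ### The plant -/

/-- The data of a port-Hamiltonian plant with states `x₁ ∈ ℝᵐ`, `x₂ ∈ ℝᵖ`, `p ≤ m`:
state-dependent interconnection and dissipation matrices, a Hamiltonian, and the point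
`(x₁*, x₂*)` where the Hamiltonian is minimal. -/
structure PHPlant (m p : ℕ) where
  J₁ : Vec m × Vec p → Matrix (Fin m) (Fin m) ℝ
  R₁ : Vec m × Vec p → Matrix (Fin m) (Fin m) ℝ
  J₁₂ : Vec m × Vec p → Matrix (Fin m) (Fin p) ℝ
  J₂ : Vec m × Vec p → Matrix (Fin p) (Fin p) ℝ
  R₂ : Vec m × Vec p → Matrix (Fin p) (Fin p) ℝ
  H : Vec m × Vec p → ℝ
  x₁s : Vec m
  x₂s : Vec p
  dim_le : p ≤ m
  J₁_skew : ∀ x, (J₁ x)ᵀ = -J₁ x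
  J₂_skew : ∀ x, (J₂ x)ᵀ = -J₂ x
  R₁_posDef : ∀ x, (R₁ x).PosDef
  R₂_posSemidef : ∀ x, (R₂ x).PosSemidef
  J₁_smooth : ∀ i j, ContDiff ℝ ∞ fun x => J₁ x i j
  R₁_smooth : ∀ i j, ContDiff ℝ ∞ fun x => R₁ x i j
  J₁₂_smooth : ∀ i j, ContDiff ℝ ∞ fun x => J₁₂ x i j
  J₂_smooth : ∀ i j, ContDiff ℝ ∞ fun x => J₂ x i j
  R₂_smooth : ∀ i j, ContDiff ℝ ∞ fun x => R₂ x i j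
  H_smooth : ContDiff ℝ ∞ H
  H_strict_min : ∀ x, x ≠ (x₁s, x₂s) → H (x₁s, x₂s) < H x

namespace PHPlant

variable {m p : ℕ} (P : PHPlant m p)

/-- Right-hand side of the `x₁` dynamics, with input `u` and matched disturbance `d₁`. -/
def dyn₁ (d₁ : Vec m) (x : Vec m × Vec p) (u : Vec m) : Vec m :=
  matAct (P.J₁ x - P.R₁ x) (gradFst P.H x) + matAct (P.J₁₂ x) (gradSnd P.H x) + u - d₁

/-- Right-hand side of the `x₂` dynamics, with unmatched disturbance `d₂`. -/
def dyn₂ (d₂ : Vec p) (x : Vec m × Vec p) : Vec p :=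
  matAct (-(P.J₁₂ x)ᵀ) (gradFst P.H x) + matAct (P.J₂ x - P.R₂ x) (gradSnd P.H x) - d₂

/-- `J₁₂` and `R₁` have full rank (everywhere). -/
def FullRank : Prop :=
  ∀ x, (P.J₁₂ x).rank = p ∧ (P.R₁ x).rank = m

/-- The mixed second derivatives `∇_{x₁x₂} H` vanish identically. -/
def NoCrossTerms : Prop :=
  ∀ (x₁ : Vec m) (x₂ : Vec p), fderiv ℝ (fun y : Vec p => gradFst P.H (x₁, y)) x₂ = 0

/-- `H` is strongly convex on `ℝ^{m+p}`. The modulus is existentially quantified, so that the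
choice among equivalent norms on the product is immaterial. -/
def HamiltonianStronglyConvex : Prop :=
  ∃ c : ℝ, 0 < c ∧ StrongConvexOn Set.univ c P.H

end PHPlant

/-! ### The integral controller and the closed loop -/

/-- The free parameters of the controller: a constant full-rank matrix `E`, and a strictly convex
function `Hc` (twice continuously differentiable) whose gradient map is invertible. -/
structure IntegralController (m p : ℕ) where
  E : Matrix (Fin m) (Fin p) ℝ
  Hc : Vec p → ℝ
  E_rank : E.rank = p
  Hc_contDiff : ContDiff ℝ 2 Hc
  Hc_strictConvex : StrictConvexOn ℝ Set.univ Hc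
  Hc_grad_bijective : Function.Bijective (gradient Hc)

namespace IntegralController

variable {m p : ℕ} (C : IntegralController m p) (P : PHPlant m p)

/-- The control law `u = (J₁ - R₁) ∇_{x₁} [Hc(Eᵀ x₁ - ζ)]`. -/
def input (x : Vec m × Vec p) (ζ : Vec p) : Vec m :=
  matAct (P.J₁ x - P.R₁ x) (gradient (fun y : Vec m => C.Hc (matAct C.Eᵀ y - ζ)) x.1)

/-- The controller dynamics `ζ̇ = Eᵀ J₁₂ ∇_{x₂} H`. -/
def dynζ (x : Vec m × Vec p) : Vec p :=
  matAct (C.Eᵀ * P.J₁₂ x) (gradSnd P.H x)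

/-- The closed-loop vector field in the state `w = (x₁, x₂, ζ)`. -/
def closedLoop (d₁ : Vec m) (d₂ : Vec p) (w : Vec m × Vec p × Vec p) : Vec m × Vec p × Vec p :=
  (P.dyn₁ d₁ (w.1, w.2.1) (C.input P (w.1, w.2.1) w.2.2),
    P.dyn₂ d₂ (w.1, w.2.1),
    C.dynζ P (w.1, w.2.1))

/-- The closed-loop Hamiltonian `H(x₁, x₂) + Hc(Eᵀ x₁ - ζ)`. -/
def Hcl (x₁ : Vec m) (x₂ ζ : Vec p) : ℝ :=
  P.H (x₁, x₂) + C.Hc (matAct C.Eᵀ x₁ - ζ)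

/-- The closed-loop Hamiltonian has partial gradients `g₁, g₂, g₃` with respect to `x₁, x₂, ζ`
at the state `w`. -/
def HclGradientIs (w : Vec m × Vec p × Vec p) (g₁ : Vec m) (g₂ g₃ : Vec p) : Prop :=
  gradient (fun y : Vec m => C.Hcl P y w.2.1 w.2.2) w.1 = g₁ ∧
  gradient (fun y : Vec p => C.Hcl P w.1 y w.2.2) w.2.1 = g₂ ∧
  gradient (fun y : Vec p => C.Hcl P w.1 w.2.1 y) w.2.2 = g₃

end IntegralController

end

/-!
Write `A = J₁ - R₁`, `a = A⁻¹ d₁`, `c = (J₁₂ᵀ E)⁻¹ (J₁₂ᵀ a + d₂)`, and tilt the closed-loop Hamiltonian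
to `W = Hcl - ⟨a, x₁⟩ + ⟨c, ζ⟩`, whose critical points are the points required by the theorem. In terms
of the gradient `(e₁, e₂, e₃)` of `W` the closed loop becomes the undisturbed port-Hamiltonian system
`ẋ₁ = A e₁ + J₁₂ e₂`, `ẋ₂ = -J₁₂ᵀ e₁ + (J₂ - R₂) e₂ - J₁₂ᵀ E e₃`, `ζ̇ = Eᵀ J₁₂ e₂`
(`IntegralController.closedLoop_eq`), so that `Ẇ = -⟨e₁, R₁ e₁⟩ - ⟨e₂, R₂ e₂⟩ ≤ 0`
(`IntegralController.fderiv_shiftedHcl_closedLoop`).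

`W` is strictly convex, because `H` and `Hc` are and `(x₁, x₂, ζ) ↦ (x₁, x₂, Eᵀ x₁ - ζ)` is injective
(`IntegralController.strictConvexOn_shiftedHcl`). Hence it has at most one critical point. One exists:
take `x₁` from the hypothesis, `x₂` at the minimum of `H` (the Hamiltonian splits as a function of `x₁`
plus a function of `x₂`), and `ζ` such that `∇Hc (Eᵀ x₁ - ζ) = c`. It is the strict global minimum of
`W`, and the sublevel sets of `W` are bounded (`ConvexOn.isBounded_sublevel`).

Since `R₂` need not be definite, the decrease of `W` is not strict and LaSalle's principle is needed
(`IsGloballyAsymptoticallyStable.of_lyapunov`). It is proved by multiplying the vector field with a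
cut-off function, which makes it globally Lipschitz without changing it on a sublevel set of `W`: this
gives global solutions, uniqueness, and continuous dependence on the initial state. Along a solution
with `Ẇ = 0` one has `e₁ = 0`; then `Eᵀ x₁ - ζ`, `∇Hc`, `∇_{x₁} H` and hence `x₁` are constant, so
`J₁₂ e₂ = 0` and `e₂ = 0`; then `x₂` is constant and the second equation leaves `e₃ = 0`
(`IntegralController.hasFDerivAt_shiftedHcl_zero_of_stationary`).
-/

open scoped InnerProductSpace

/-! ### Lipschitz vector fields and truncation -/

section Dynamics

variable {X : Type*} [NormedAddCommGroup X] [NormedSpace ℝ X]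

/-- A bounded Lipschitz `C¹` vector field is complete: the Picard–Lindelöf time can be chosen
uniformly in the initial point. -/
theorem exists_isIntegralCurve_of_lipschitzWith_of_bounded [CompleteSpace X] {g : X → X}
    (hg : ContDiff ℝ 1 g) {K L : NNReal} (hK : LipschitzWith K g) (hL : ∀ x, ‖g x‖ ≤ L) (x : X) :
    ∃ γ : ℝ → X, γ 0 = x ∧ IsIntegralCurve γ (fun _ => g) := by
  have key : ∃ γ : ℝ → X, γ 0 = x ∧
      IsMIntegralCurve (I := modelWithCornersSelf ℝ X) (M := X) γ g := by
    refine exists_isMIntegralCurve_of_isMIntegralCurveOn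
      (contMDiff_vectorSpace_iff_contDiff.2 hg) one_pos (fun y => ?_) x
    have hpl : IsPicardLindelof (fun _ : ℝ => g) (tmin := -1) (tmax := 1)
        ⟨0, by norm_num, by norm_num⟩ y L 0 L K :=
      IsPicardLindelof.of_time_independent (fun z _ => hL z) hK.lipschitzOnWith (by simp)
    obtain ⟨α, h0, hα⟩ := hpl.exists_eq_forall_mem_Icc_hasDerivWithinAt₀
    refine ⟨α, h0, fun t ht => ?_⟩
    exact ((hα t (Set.Ioo_subset_Icc_self ht)).mono
      Set.Ioo_subset_Icc_self).hasFDerivWithinAt.hasMFDerivWithinAt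
  obtain ⟨γ, h0, hγ⟩ := key
  exact ⟨γ, h0, fun t => by
    have h : HasFDerivAt γ ((1 : ℝ →L[ℝ] ℝ).smulRight (g (γ t)) : ℝ →L[ℝ] X) t :=
      hasMFDerivAt_iff_hasFDerivAt.1 (hγ t)
    simpa using h.hasDerivAt⟩

/-- A `C¹` vector field can be multiplied by a cut-off function so as to become bounded and
globally Lipschitz without being altered on a given bounded set. -/
theorem exists_truncation [FiniteDimensional ℝ X] {f : X → X} (hf : ContDiff ℝ 1 f)
    {S : Set X} (hS : Bornology.IsBounded S) :
    ∃ (g : X → X) (K L : NNReal), ContDiff ℝ 1 g ∧ LipschitzWith K g ∧ (∀ x, ‖g x‖ ≤ L) ∧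
      Set.EqOn g f S ∧ ∀ x, ∃ a : ℝ, 0 ≤ a ∧ g x = a • f x := by
  obtain ⟨R, hR⟩ := hS.subset_closedBall (0 : X)
  let χ : ContDiffBump (0 : X) := ⟨max R 1, max R 1 + 1, by positivity, by linarith⟩
  have hg : ContDiff ℝ 1 (fun x => χ x • f x) := χ.contDiff.smul hf
  have hc : HasCompactSupport (fun x => χ x • f x) := χ.hasCompactSupport.smul_right
  obtain ⟨K, hK⟩ := hg.lipschitzWith_of_hasCompactSupport hc one_ne_zero
  obtain ⟨L, hL⟩ := hc.exists_bound_of_continuous hg.continuous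
  refine ⟨_, K, L.toNNReal, hg, hK, fun x => (hL x).trans (Real.le_coe_toNNReal L),
    fun x hx => ?_, fun x => ⟨χ x, χ.nonneg, rfl⟩⟩
  have : χ x = 1 := χ.one_of_mem_closedBall
    (Metric.closedBall_subset_closedBall (le_max_left _ _) (hR hx))
  simp [this]

theorem SolvesOn.hasDerivWithinAt_Ici {f : X → X} {γ : ℝ → X} {T : ℝ}
    (h : SolvesOn f γ (Set.Ico 0 T)) {t : ℝ} (ht : t ∈ Set.Ico 0 T) :
    HasDerivWithinAt γ (f (γ t)) (Set.Ici t) t :=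
  (h t ht).mono_of_mem_nhdsWithin <|
    Filter.mem_of_superset (Ico_mem_nhdsGE ht.2) (Set.Ico_subset_Ico_left ht.1)

/-- A function does not increase along solutions of `ẇ = f(w)` if its derivative along `f` is
nonpositive. -/
theorem SolvesOn.antitoneOn {f : X → X} {W : X → ℝ} (hW : Differentiable ℝ W)
    (hdec : ∀ x, fderiv ℝ W x (f x) ≤ 0) {γ : ℝ → X} {s : Set ℝ} (hs : Convex ℝ s)
    (h : SolvesOn f γ s) : AntitoneOn (fun t => W (γ t)) s := by
  have hd : ∀ t ∈ s, HasDerivWithinAt (fun t => W (γ t)) (fderiv ℝ W (γ t) (f (γ t))) s t :=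
    fun t ht => (hW (γ t)).hasFDerivAt.comp_hasDerivWithinAt t (h t ht)
  refine antitoneOn_of_deriv_nonpos hs (fun t ht => (hd t ht).continuousWithinAt)
    (fun t ht => ?_) (fun t ht => ?_)
  · exact ((hd t (interior_subset ht)).mono interior_subset).differentiableWithinAt
  · rw [((hd t (interior_subset ht)).hasDerivAt (mem_interior_iff_mem_nhds.1 ht)).deriv]
    exact hdec _

/-! ### LaSalle's invariance principle -/

/-- If a function with bounded sublevel sets does not increase along `f`, then the solutions of
`ẇ = f(w)` exist for all positive times and are unique. -/
theorem exists_unique_solvesOn_of_lyapunov [FiniteDimensional ℝ X] {f : X → X}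
    (hf : ContDiff ℝ 1 f) {W : X → ℝ} (hW : Differentiable ℝ W)
    (hdec : ∀ x, fderiv ℝ W x (f x) ≤ 0)
    (hbdd : ∀ c, Bornology.IsBounded {x | W x ≤ c}) (w₀ : X) :
    ∃ γ : ℝ → X, γ 0 = w₀ ∧ SolvesOn f γ (Set.Ici 0) ∧
      ∀ (T : ℝ) (η : ℝ → X), η 0 = w₀ → SolvesOn f η (Set.Ico 0 T) →
        Set.EqOn η γ (Set.Ico 0 T) := by
  have := FiniteDimensional.complete ℝ X
  obtain ⟨g, K, L, hg, hK, hL, hgf, hpos⟩ := exists_truncation hf (hbdd (W w₀))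
  obtain ⟨γ, h0, hγ⟩ := exists_isIntegralCurve_of_lipschitzWith_of_bounded hg hK hL w₀
  have hgdec : ∀ x, fderiv ℝ W x (g x) ≤ 0 := fun x => by
    obtain ⟨a, ha, hx⟩ := hpos x
    rw [hx, map_smul, smul_eq_mul]
    exact mul_nonpos_of_nonneg_of_nonpos ha (hdec x)
  have hγW : ∀ t ∈ Set.Ici (0 : ℝ), W (γ t) ≤ W w₀ := fun t ht => by
    have := SolvesOn.antitoneOn hW hgdec (convex_Ici 0) (hγ.isIntegralCurveOn _)
      (Set.self_mem_Ici) ht ht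
    simpa [h0] using this
  refine ⟨γ, h0, fun t ht => ?_, fun T η hη0 hη t ht => ?_⟩
  · have h : HasDerivWithinAt γ (g (γ t)) (Set.Ici 0) t := (hγ t).hasDerivWithinAt
    rwa [hgf (hγW t ht)] at h
  · have hηW : ∀ s ∈ Set.Ico 0 T, W (η s) ≤ W w₀ := fun s hs => by
      have := hη.antitoneOn hW hdec (convex_Ico 0 T)
        (Set.left_mem_Ico.2 (hs.1.trans_lt hs.2)) hs hs.1
      simpa [hη0] using this
    have hsub : Set.Icc 0 t ⊆ Set.Ico 0 T := fun s hs => ⟨hs.1, hs.2.trans_lt ht.2⟩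
    refine ODE_solution_unique (v := fun _ => g) (K := K) (fun _ => hK)
      (hη.continuousOn.mono hsub) (fun s hs => ?_) hγ.continuous.continuousOn
      (fun s hs => (hγ s).hasDerivWithinAt) (by rw [hη0, h0])
      (Set.right_mem_Icc.2 ht.1)
    have hs' := hsub (Set.Ico_subset_Icc_self hs)
    rw [hgf (hηW s hs')]
    exact hη.hasDerivWithinAt_Ici hs'

/-- Solutions on `[0, ∞)` that stay in a bounded set depend continuously on the initial state. -/
theorem exists_dist_le_of_solvesOn [FiniteDimensional ℝ X] {f : X → X} (hf : ContDiff ℝ 1 f)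
    {S : Set X} (hS : Bornology.IsBounded S) :
    ∃ K : ℝ, ∀ γ σ : ℝ → X, SolvesOn f γ (Set.Ici 0) → SolvesOn f σ (Set.Ici 0) →
      (∀ t ≥ 0, γ t ∈ S) → (∀ t ≥ 0, σ t ∈ S) →
      ∀ t ≥ 0, dist (γ t) (σ t) ≤ dist (γ 0) (σ 0) * Real.exp (K * t) := by
  obtain ⟨g, K, L, hg, hK, hL, hgf, -⟩ := exists_truncation hf hS
  refine ⟨K, fun γ σ hγ hσ hγS hσS t ht => ?_⟩
  have aux : ∀ η : ℝ → X, SolvesOn f η (Set.Ici 0) → (∀ t ≥ 0, η t ∈ S) →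
      ContinuousOn η (Set.Icc 0 t) ∧
        ∀ s ∈ Set.Ico 0 t, HasDerivWithinAt η (g (η s)) (Set.Ici s) s := fun η hη hηS =>
    ⟨hη.continuousOn.mono Set.Icc_subset_Ici_self, fun s hs => by
      rw [hgf (hηS s hs.1)]
      exact (hη s hs.1).mono (Set.Ici_subset_Ici.2 hs.1)⟩
  simpa using dist_le_of_trajectories_ODE (v := fun _ => g) (K := K) (fun _ => hK)
    (aux γ hγ hγS).1 (aux γ hγ hγS).2 (aux σ hσ hσS).1 (aux σ hσ hσS).2 le_rfl t ⟨ht, le_rfl⟩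

theorem SolvesOn.comp_add_right {f : X → X} {γ : ℝ → X} (h : SolvesOn f γ (Set.Ici 0)) {a : ℝ}
    (ha : 0 ≤ a) : SolvesOn f (fun t => γ (t + a)) (Set.Ici 0) := fun t ht => by
  have h1 := h (t + a) (add_nonneg ht ha)
  have h2 : HasDerivWithinAt (fun t : ℝ => t + a) 1 (Set.Ici 0) t :=
    ((hasDerivAt_id t).add_const a).hasDerivWithinAt
  simpa [Function.comp_def] using h1.scomp t h2 (fun s hs => add_nonneg hs ha)

/-- Sublevel sets of a continuous function with bounded sublevel sets shrink to a strict global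
minimiser. -/
theorem exists_sublevel_subset_ball {Y : Type*} [NormedAddCommGroup Y] [ProperSpace Y] {W : Y → ℝ} (hW : Continuous W)
    (hbdd : ∀ c, Bornology.IsBounded {x | W x ≤ c}) {e : Y} (hmin : ∀ x, x ≠ e → W e < W x)
    {ε : ℝ} (hε : 0 < ε) : ∃ c, W e < c ∧ ∀ x, W x < c → ‖x - e‖ < ε := by
  have hcpt : IsCompact ({x | W x ≤ W e + 1} ∩ {x | ε ≤ ‖x - e‖}) :=
    Metric.isCompact_of_isClosed_isBounded
      ((isClosed_le hW continuous_const).inter (isClosed_le continuous_const (by fun_prop)))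
      ((hbdd _).subset Set.inter_subset_left)
  rcases Set.eq_empty_or_nonempty ({x | W x ≤ W e + 1} ∩ {x | ε ≤ ‖x - e‖}) with h | h
  · refine ⟨W e + 1, by linarith, fun x hx => ?_⟩
    by_contra! hcon
    exact Set.notMem_empty x (h ▸ ⟨hx.le, hcon⟩)
  · obtain ⟨z, hz, hzmin⟩ := hcpt.exists_isMinOn h hW.continuousOn
    have hze : z ≠ e := by
      rintro rfl
      have : ε ≤ ‖z - z‖ := hz.2
      simp only [sub_self, norm_zero] at this
      linarith
    refine ⟨min (W z) (W e + 1), lt_min (hmin z hze) (by linarith), fun x hx => ?_⟩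
    by_contra! hcon
    have h1 := hx.trans_le (min_le_right _ _)
    exact absurd (hzmin (show x ∈ _ from ⟨h1.le, hcon⟩)) (not_le.2 (hx.trans_le (min_le_left _ _)))

/-- **LaSalle's invariance principle**, in the form of a criterion for global asymptotic
stability: there is a function with bounded sublevel sets and a strict minimum at `e` that does not
increase along `f`, and every solution on `[0, ∞)` along which its derivative vanishes starts at `e`. -/
theorem IsGloballyAsymptoticallyStable.of_lyapunov [FiniteDimensional ℝ X] {f : X → X}
    (hf : ContDiff ℝ 1 f) {W : X → ℝ} (hW : Differentiable ℝ W)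
    (hdec : ∀ x, fderiv ℝ W x (f x) ≤ 0)
    (hbdd : ∀ c, Bornology.IsBounded {x | W x ≤ c}) {e : X} (hmin : ∀ x, x ≠ e → W e < W x)
    (he : f e = 0)
    (hinv : ∀ γ : ℝ → X, SolvesOn f γ (Set.Ici 0) →
      (∀ t ≥ 0, fderiv ℝ W (γ t) (f (γ t)) = 0) → γ 0 = e) :
    IsGloballyAsymptoticallyStable f e := by
  have := FiniteDimensional.proper_real X
  have hanti : ∀ γ : ℝ → X, SolvesOn f γ (Set.Ici 0) → AntitoneOn (fun t => W (γ t)) (Set.Ici 0) :=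
    fun γ hγ => hγ.antitoneOn hW hdec (convex_Ici 0)
  have hle0 : ∀ γ : ℝ → X, SolvesOn f γ (Set.Ici 0) → ∀ t ≥ 0, W (γ t) ≤ W (γ 0) :=
    fun γ hγ t ht => hanti γ hγ Set.self_mem_Ici ht ht
  have hglob : ∀ x, W e ≤ W x := fun x => by
    by_cases h : x = e
    · rw [h]
    · exact (hmin x h).le
  have hcomp := exists_unique_solvesOn_of_lyapunov hf hW hdec hbdd
  refine ⟨he, hcomp, fun ε hε => ?_, fun γ hγ => ?_⟩
  · obtain ⟨c, hc, hcε⟩ := exists_sublevel_subset_ball hW.continuous hbdd hmin hε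
    obtain ⟨δ, hδ, hδc⟩ := Metric.eventually_nhds_iff.1
      (hW.continuous.continuousAt.eventually_lt continuousAt_const hc)
    refine ⟨δ, hδ, fun γ hγ h0 t ht => hcε _ ((hle0 γ hγ t ht).trans_lt (hδc ?_))⟩
    rwa [dist_eq_norm]
  · set S : Set X := {x | W x ≤ W (γ 0)} with hS
    have hScpt : IsCompact S := Metric.isCompact_of_isClosed_isBounded
      (isClosed_le hW.continuous continuous_const) (hbdd _)
    -- the Lyapunov function converges along `γ`
    obtain ⟨l, hl⟩ : ∃ l, Filter.Tendsto (fun t => W (γ t)) Filter.atTop (nhds l) := by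
      have hmono : Antitone (fun t : ℝ => W (γ (max t 0))) := fun a b hab =>
        hanti γ hγ (le_max_right a 0) (le_max_right b 0) (max_le_max_right 0 hab)
      refine ⟨_, (tendsto_atTop_ciInf hmono
        ⟨W e, by rintro _ ⟨t, rfl⟩; exact hglob _⟩).congr' ?_⟩
      filter_upwards [Filter.eventually_ge_atTop 0] with t ht
      rw [max_eq_left ht]
    refine hScpt.tendsto_nhds_of_unique_mapClusterPt ?_ fun x hx hcl => ?_
    · filter_upwards [Filter.eventually_ge_atTop 0] with t ht using hle0 γ hγ t ht
    obtain ⟨U, hU, hUx⟩ := mapClusterPt_iff_ultrafilter.1 hcl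
    obtain ⟨σ, hσ0, hσ, -⟩ := hcomp x
    obtain ⟨K, hK⟩ := exists_dist_le_of_solvesOn hf (hbdd (W (γ 0)))
    have hσS : ∀ t ≥ 0, σ t ∈ S := fun t ht => by
      have := hle0 σ hσ t ht
      rw [hσ0] at this
      exact this.trans hx
    -- the solution through a cluster point is a limit of time shifts of `γ`
    have hlim : ∀ s ≥ 0, W (σ s) = l := fun s hs => by
      have h1 : Filter.Tendsto (fun t => γ (s + t)) U (nhds (σ s)) := by
        rw [tendsto_iff_dist_tendsto_zero] at hUx ⊢
        refine squeeze_zero' (.of_forall fun _ => dist_nonneg) ?_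
          (by simpa using hUx.mul_const (Real.exp (K * s)))
        filter_upwards [hU (Filter.eventually_ge_atTop 0)] with t ht
        have := hK (fun r => γ (r + t)) σ (hγ.comp_add_right ht) hσ
          (fun r hr => hle0 γ hγ _ (add_nonneg hr ht)) hσS s hs
        simpa [hσ0] using this
      have h2 := (hW.continuous.tendsto (σ s)).comp h1
      have h3 : Filter.Tendsto (fun t => W (γ (s + t))) U (nhds l) :=
        (hl.comp (Filter.tendsto_atTop_add_const_left _ s Filter.tendsto_id)).mono_left hU
      exact tendsto_nhds_unique h2 h3
    rw [← hσ0]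
    refine hinv σ hσ fun t ht => ?_
    have h1 : HasDerivWithinAt (fun t => W (σ t)) (fderiv ℝ W (σ t) (f (σ t))) (Set.Ici 0) t :=
      (hW (σ t)).hasFDerivAt.comp_hasDerivWithinAt t (hσ t ht)
    have h2 : HasDerivWithinAt (fun t => W (σ t)) 0 (Set.Ici 0) t :=
      (hasDerivWithinAt_const t (Set.Ici 0) l).congr (fun s hs => hlim s hs) (hlim t ht)
    exact (uniqueDiffOn_Ici (0 : ℝ) t ht).eq_deriv _ h1 h2

end Dynamics

/-! ### Differentiable convex functions -/

section Convexity

variable {X : Type*} [NormedAddCommGroup X] [NormedSpace ℝ X]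

/-- A convex function lies above its tangent planes. -/
theorem ConvexOn.add_fderiv_le {f : X → ℝ} (hf : ConvexOn ℝ Set.univ f) {f' : X →L[ℝ] ℝ} {x : X}
    (hx : HasFDerivAt f f' x) (y : X) : f x + f' (y - x) ≤ f y := by
  have hline : ConvexOn ℝ Set.univ (f ∘ AffineMap.lineMap (k := ℝ) x y) := by
    simpa using hf.comp_affineMap (AffineMap.lineMap (k := ℝ) x y)
  have hd : HasDerivAt (f ∘ AffineMap.lineMap (k := ℝ) x y) (f' (y - x)) 0 :=
    HasFDerivAt.comp_hasDerivAt (0 : ℝ) (by simpa using hx) AffineMap.hasDerivAt_lineMap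
  have := hline.le_slope_of_hasDerivAt (Set.mem_univ 0) (Set.mem_univ 1) one_pos hd
  simp only [slope_def_field, Function.comp_apply, AffineMap.lineMap_apply_one,
    AffineMap.lineMap_apply_zero, sub_zero, div_one] at this
  linarith

theorem StrictConvexOn.add_fderiv_lt {f : X → ℝ} (hf : StrictConvexOn ℝ Set.univ f)
    {f' : X →L[ℝ] ℝ} {x : X} (hx : HasFDerivAt f f' x) {y : X} (hxy : x ≠ y) :
    f x + f' (y - x) < f y := by
  have h1 := hf.convexOn.add_fderiv_le hx ((1 / 2 : ℝ) • x + (1 / 2 : ℝ) • y)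
  have h2 := hf.2 (Set.mem_univ x) (Set.mem_univ y) hxy
    (show (0 : ℝ) < 1 / 2 by norm_num) (show (0 : ℝ) < 1 / 2 by norm_num) (by norm_num)
  have h3 : (1 / 2 : ℝ) • x + (1 / 2 : ℝ) • y - x = (1 / 2 : ℝ) • (y - x) := by module
  rw [h3, map_smul] at h1
  simp only [smul_eq_mul] at h1 h2
  linarith

/-- The derivative of a strictly convex function is injective. -/
theorem StrictConvexOn.eq_of_hasFDerivAt {f : X → ℝ} (hf : StrictConvexOn ℝ Set.univ f)
    {f' : X →L[ℝ] ℝ} {x y : X} (hx : HasFDerivAt f f' x) (hy : HasFDerivAt f f' y) : x = y := by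
  by_contra hxy
  have h1 := hf.add_fderiv_lt hx hxy
  have h2 := hf.add_fderiv_lt hy (Ne.symm hxy)
  rw [← neg_sub y x, map_neg] at h2
  linarith

/-- In finite dimension, a continuous convex function with a strict minimum has bounded sublevel
sets: it grows at least linearly away from the minimiser. -/
theorem ConvexOn.isBounded_sublevel [FiniteDimensional ℝ X] {f : X → ℝ}
    (hf : ConvexOn ℝ Set.univ f) (hc : Continuous f) {e : X} (hmin : ∀ x, x ≠ e → f e < f x)
    (c : ℝ) : Bornology.IsBounded {x | f x ≤ c} := by
  have := FiniteDimensional.proper_real X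
  obtain ⟨μ, hμ, hsph⟩ : ∃ μ > 0, ∀ y ∈ Metric.sphere e 1, f e + μ ≤ f y := by
    rcases (Metric.sphere e 1).eq_empty_or_nonempty with h | h
    · exact ⟨1, one_pos, by simp [h]⟩
    · obtain ⟨z, hz, hzmin⟩ := (isCompact_sphere e 1).exists_isMinOn h hc.continuousOn
      have hze : z ≠ e := by
        rintro rfl
        simp at hz
      refine ⟨f z - f e, sub_pos.2 (hmin z hze), fun y hy => ?_⟩
      have : f z ≤ f y := hzmin hy
      linarith
  refine (Metric.isBounded_closedBall (x := e) (r := max 1 ((c - f e) / μ))).subset fun x hx => ?_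
  rw [Metric.mem_closedBall, dist_eq_norm]
  by_contra! hcon
  have hr1 : 1 < ‖x - e‖ := (le_max_left _ _).trans_lt hcon
  have hr2 : c - f e < ‖x - e‖ * μ := (div_lt_iff₀ hμ).1 ((le_max_right _ _).trans_lt hcon)
  set r := ‖x - e‖ with hr
  have hr0 : 0 < r := by linarith
  have hinv : r⁻¹ ≤ 1 := inv_le_one_of_one_le₀ hr1.le
  -- the point of the segment from `e` to `x` at distance one from `e`
  have hy : (1 - r⁻¹) • e + r⁻¹ • x ∈ Metric.sphere e 1 := by
    have : (1 - r⁻¹) • e + r⁻¹ • x - e = r⁻¹ • (x - e) := by module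
    rw [mem_sphere_iff_norm, this, norm_smul, ← hr, Real.norm_of_nonneg (by positivity),
      inv_mul_cancel₀ hr0.ne']
  have h1 := hsph _ hy
  have h2 := hf.2 (Set.mem_univ e) (Set.mem_univ x)
    (sub_nonneg.2 hinv) (inv_nonneg.2 hr0.le) (by ring)
  simp only [smul_eq_mul] at h2
  have hxc : f x ≤ c := hx
  have h3 : μ ≤ r⁻¹ * (f x - f e) := by linarith
  have h4 : r * μ ≤ f x - f e := by
    have := mul_le_mul_of_nonneg_left h3 hr0.le
    rwa [← mul_assoc, mul_inv_cancel₀ hr0.ne', one_mul] at this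
  linarith

end Convexity

/-! ### Matrices acting on Euclidean vectors -/

section MatAct

variable {k m n : ℕ}

/-- `matAct A` as a continuous linear map. -/
noncomputable def matActL (A : Matrix (Fin m) (Fin n) ℝ) : Vec n →L[ℝ] Vec m :=
  LinearMap.toContinuousLinearMap (Matrix.toEuclideanLin A)

theorem matActL_apply (A : Matrix (Fin m) (Fin n) ℝ) (v : Vec n) : matActL A v = matAct A v := rfl

theorem matAct_vadd (A : Matrix (Fin m) (Fin n) ℝ) (v w : Vec n) :
    matAct A (v + w) = matAct A v + matAct A w := (matActL A).map_add v w

theorem matAct_vsub (A : Matrix (Fin m) (Fin n) ℝ) (v w : Vec n) :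
    matAct A (v - w) = matAct A v - matAct A w := (matActL A).map_sub v w

theorem matAct_zero (A : Matrix (Fin m) (Fin n) ℝ) : matAct A 0 = 0 := (matActL A).map_zero

theorem matAct_sub (A B : Matrix (Fin m) (Fin n) ℝ) (v : Vec n) :
    matAct (A - B) v = matAct A v - matAct B v := by
  simp [matAct, Matrix.sub_mulVec]

theorem matAct_neg (A : Matrix (Fin m) (Fin n) ℝ) (v : Vec n) :
    matAct (-A) v = -matAct A v := by
  simp [matAct, Matrix.neg_mulVec]

theorem matAct_mul (A : Matrix (Fin k) (Fin m) ℝ) (B : Matrix (Fin m) (Fin n) ℝ) (v : Vec n) :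
    matAct (A * B) v = matAct A (matAct B v) := by
  simp [matAct]

theorem matAct_one (v : Vec n) : matAct 1 v = v := by
  simp [matAct]

theorem inner_matAct_right (A : Matrix (Fin m) (Fin n) ℝ) (v : Vec m) (w : Vec n) :
    ⟪v, matAct A w⟫_ℝ = ⟪matAct Aᵀ v, w⟫_ℝ := by
  simp only [EuclideanSpace.inner_eq_star_dotProduct, matAct, star_trivial]
  rw [Matrix.mulVec_transpose, dotProduct_comm, Matrix.dotProduct_mulVec, dotProduct_comm]

theorem inner_matAct_self_of_skew {A : Matrix (Fin n) (Fin n) ℝ} (hA : Aᵀ = -A) (v : Vec n) :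
    ⟪v, matAct A v⟫_ℝ = 0 := by
  have h := inner_matAct_right A v v
  rw [hA, matAct_neg, inner_neg_left, real_inner_comm v] at h
  linarith

theorem inner_matAct_self_nonneg {A : Matrix (Fin n) (Fin n) ℝ} (hA : A.PosSemidef) (v : Vec n) :
    0 ≤ ⟪v, matAct A v⟫_ℝ := by
  have := hA.dotProduct_mulVec_nonneg v.ofLp
  rwa [EuclideanSpace.inner_eq_star_dotProduct, dotProduct_comm]

theorem inner_matAct_self_pos {A : Matrix (Fin n) (Fin n) ℝ} (hA : A.PosDef) {v : Vec n}
    (hv : v ≠ 0) : 0 < ⟪v, matAct A v⟫_ℝ := by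
  have := hA.dotProduct_mulVec_pos (x := v.ofLp) (by simpa using hv)
  rwa [EuclideanSpace.inner_eq_star_dotProduct, dotProduct_comm]

theorem matAct_injective_of_isUnit {A : Matrix (Fin n) (Fin n) ℝ} (hA : IsUnit A) :
    Function.Injective (matAct A) := fun v w h => by
  have := congrArg (matAct A⁻¹) h
  simpa only [← matAct_mul, Matrix.nonsing_inv_mul A ((Matrix.isUnit_iff_isUnit_det A).1 hA),
    matAct_one] using this

theorem matAct_matAct_inv {A : Matrix (Fin n) (Fin n) ℝ} (hA : IsUnit A) (v : Vec n) :
    matAct A (matAct A⁻¹ v) = v := by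
  rw [← matAct_mul, Matrix.mul_nonsing_inv A ((Matrix.isUnit_iff_isUnit_det A).1 hA), matAct_one]

/-- A matrix with negative definite symmetric part is invertible. -/
theorem isUnit_skew_sub_posDef {J R : Matrix (Fin n) (Fin n) ℝ} (hJ : Jᵀ = -J) (hR : R.PosDef) :
    IsUnit (J - R) := by
  refine Matrix.mulVec_injective_iff_isUnit.1 fun v w h => ?_
  by_contra hvw
  have hne : WithLp.toLp 2 (v - w) ≠ 0 := by simpa [sub_eq_zero] using hvw
  have h0 : matAct (J - R) (WithLp.toLp 2 (v - w)) = 0 := by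
    simp [matAct, Matrix.mulVec_sub, show (J - R) *ᵥ v = (J - R) *ᵥ w from h]
  have h1 := inner_matAct_self_pos hR hne
  have h2 := inner_matAct_self_of_skew hJ (WithLp.toLp 2 (v - w))
  have h3 : ⟪WithLp.toLp 2 (v - w), matAct (J - R) (WithLp.toLp 2 (v - w))⟫_ℝ = 0 := by
    rw [h0, inner_zero_right]
  rw [matAct_sub, inner_sub_right] at h3
  linarith

theorem contDiff_matAct {X : Type*} [NormedAddCommGroup X] [NormedSpace ℝ X] {r : WithTop ℕ∞}
    {A : X → Matrix (Fin m) (Fin n) ℝ} {v : X → Vec n}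
    (hA : ∀ i j, ContDiff ℝ r fun x => A x i j) (hv : ContDiff ℝ r v) :
    ContDiff ℝ r fun x => matAct (A x) (v x) := by
  refine contDiff_euclidean.2 fun i => ?_
  simp only [matAct, Matrix.mulVec, dotProduct]
  exact ContDiff.sum fun j _ => (hA i j).mul (contDiff_euclidean.1 hv j)

end MatAct

/-! ### Partial gradients -/

section PartialGradients

variable {m p : ℕ}

theorem gradFst_eq {f : Vec m × Vec p → ℝ} {x : Vec m × Vec p} (hf : DifferentiableAt ℝ f x) :
    gradFst f x = (InnerProductSpace.toDual ℝ (Vec m)).symm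
      ((fderiv ℝ f x).comp (ContinuousLinearMap.inl ℝ (Vec m) (Vec p))) := by
  have h : HasFDerivAt (fun y : Vec m => f (y, x.2))
      ((fderiv ℝ f x).comp (ContinuousLinearMap.inl ℝ (Vec m) (Vec p))) x.1 :=
    HasFDerivAt.comp x.1 hf.hasFDerivAt (hasFDerivAt_prodMk_left x.1 x.2)
  rw [gradFst, gradient, h.fderiv]

theorem gradSnd_eq {f : Vec m × Vec p → ℝ} {x : Vec m × Vec p} (hf : DifferentiableAt ℝ f x) :
    gradSnd f x = (InnerProductSpace.toDual ℝ (Vec p)).symm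
      ((fderiv ℝ f x).comp (ContinuousLinearMap.inr ℝ (Vec m) (Vec p))) := by
  have h : HasFDerivAt (fun y : Vec p => f (x.1, y))
      ((fderiv ℝ f x).comp (ContinuousLinearMap.inr ℝ (Vec m) (Vec p))) x.2 :=
    HasFDerivAt.comp x.2 hf.hasFDerivAt (hasFDerivAt_prodMk_right x.1 x.2)
  rw [gradSnd, gradient, h.fderiv]

theorem fderiv_apply_eq_inner_gradFst_add {f : Vec m × Vec p → ℝ} {x : Vec m × Vec p}
    (hf : DifferentiableAt ℝ f x) (v : Vec m × Vec p) :
    fderiv ℝ f x v = ⟪gradFst f x, v.1⟫_ℝ + ⟪gradSnd f x, v.2⟫_ℝ := by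
  rw [gradFst_eq hf, gradSnd_eq hf, InnerProductSpace.toDual_symm_apply,
    InnerProductSpace.toDual_symm_apply, ContinuousLinearMap.comp_apply,
    ContinuousLinearMap.comp_apply, ← map_add]
  simp

theorem hasGradientAt_gradFst {f : Vec m × Vec p → ℝ} (hf : Differentiable ℝ f)
    (x₁ : Vec m) (x₂ : Vec p) :
    HasGradientAt (fun y => f (y, x₂)) (gradFst f (x₁, x₂)) x₁ :=
  DifferentiableAt.hasGradientAt (f := fun y => f (y, x₂)) (by fun_prop)

theorem hasGradientAt_gradSnd {f : Vec m × Vec p → ℝ} (hf : Differentiable ℝ f)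
    (x₁ : Vec m) (x₂ : Vec p) :
    HasGradientAt (fun y => f (x₁, y)) (gradSnd f (x₁, x₂)) x₂ :=
  DifferentiableAt.hasGradientAt (f := fun y => f (x₁, y)) (by fun_prop)

theorem contDiff_gradFst {f : Vec m × Vec p → ℝ} (hf : ContDiff ℝ 2 f) :
    ContDiff ℝ 1 (gradFst f) := by
  have h : gradFst f = _ :=
    funext fun x => gradFst_eq (hf.differentiable (by norm_num) x)
  rw [h]
  exact (LinearIsometryEquiv.contDiff _).comp
    ((hf.fderiv_right (m := 1) (by norm_num)).clm_comp contDiff_const)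

theorem contDiff_gradSnd {f : Vec m × Vec p → ℝ} (hf : ContDiff ℝ 2 f) :
    ContDiff ℝ 1 (gradSnd f) := by
  have h : gradSnd f = _ :=
    funext fun x => gradSnd_eq (hf.differentiable (by norm_num) x)
  rw [h]
  exact (LinearIsometryEquiv.contDiff _).comp
    ((hf.fderiv_right (m := 1) (by norm_num)).clm_comp contDiff_const)

theorem contDiff_gradient {f : Vec p → ℝ} (hf : ContDiff ℝ 2 f) : ContDiff ℝ 1 (gradient f) :=
  (LinearIsometryEquiv.contDiff _).comp (hf.fderiv_right (m := 1) (by norm_num))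

theorem HasGradientAt.comp_matAct_sub {f : Vec p → ℝ} {A : Matrix (Fin p) (Fin m) ℝ} {c g : Vec p}
    {y : Vec m} (h : HasGradientAt f g (matAct A y - c)) :
    HasGradientAt (fun y => f (matAct A y - c)) (matAct Aᵀ g) y := by
  have h1 := HasFDerivAt.comp y h.hasFDerivAt ((matActL A).hasFDerivAt.sub_const c)
  refine hasGradientAt_iff_hasFDerivAt.2 (h1.congr_fderiv ?_)
  ext v
  simp [matActL_apply, inner_matAct_right]

theorem StrictConvexOn.eq_of_hasGradientAt {f : Vec p → ℝ} (hf : StrictConvexOn ℝ Set.univ f)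
    {g x y : Vec p} (hx : HasGradientAt f g x) (hy : HasGradientAt f g y) : x = y :=
  hf.eq_of_hasFDerivAt hx.hasFDerivAt hy.hasFDerivAt

theorem StrictConvexOn.prodMk_right {f : Vec m × Vec p → ℝ} (hf : StrictConvexOn ℝ Set.univ f)
    (b : Vec p) : StrictConvexOn ℝ Set.univ fun y => f (y, b) := by
  refine ⟨convex_univ, fun x _ y _ hxy s t hs ht hst => ?_⟩
  have := hf.2 (Set.mem_univ (x, b)) (Set.mem_univ (y, b)) (by simpa using hxy) hs ht hst
  simpa [← add_smul, hst] using this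

theorem StrictConvexOn.prodMk_left {f : Vec m × Vec p → ℝ} (hf : StrictConvexOn ℝ Set.univ f)
    (a : Vec m) : StrictConvexOn ℝ Set.univ fun y => f (a, y) := by
  refine ⟨convex_univ, fun x _ y _ hxy s t hs ht hst => ?_⟩
  have := hf.2 (Set.mem_univ (a, x)) (Set.mem_univ (a, y)) (by simpa using hxy) hs ht hst
  simpa [← add_smul, hst] using this

end PartialGradients

namespace PHPlant

variable {m p : ℕ} {P : PHPlant m p}

theorem differentiable_H (P : PHPlant m p) : Differentiable ℝ P.H :=
  P.H_smooth.differentiable (by simp)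

theorem contDiff_two_H (P : PHPlant m p) : ContDiff ℝ 2 P.H :=
  contDiff_infty.1 P.H_smooth 2

theorem HamiltonianStronglyConvex.strictConvexOn (h : P.HamiltonianStronglyConvex) :
    StrictConvexOn ℝ Set.univ P.H :=
  h.elim fun _ hc => hc.2.strictConvexOn hc.1

theorem NoCrossTerms.gradFst_congr (h : P.NoCrossTerms) (x₁ : Vec m) (x₂ x₂' : Vec p) :
    gradFst P.H (x₁, x₂) = gradFst P.H (x₁, x₂') := by
  have hd : Differentiable ℝ fun y : Vec p => gradFst P.H (x₁, y) :=
    ((contDiff_gradFst P.contDiff_two_H).differentiable one_ne_zero).comp (by fun_prop)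
  exact is_const_of_fderiv_eq_zero hd (h x₁) x₂ x₂'

/-- Without cross terms the Hamiltonian is a sum of a function of `x₁` and a function of `x₂`, so
the gradient in `x₂` does not depend on `x₁` either. -/
theorem NoCrossTerms.gradSnd_congr (h : P.NoCrossTerms) (x₁ x₁' : Vec m) (x₂ : Vec p) :
    gradSnd P.H (x₁, x₂) = gradSnd P.H (x₁', x₂) := by
  have hsplit : ∀ y : Vec p, P.H (x₁, y) - P.H (x₁, x₂) = P.H (x₁', y) - P.H (x₁', x₂) := by
    intro y
    have hd : ∀ z : Vec m, HasFDerivAt (fun z => P.H (z, y) - P.H (z, x₂)) 0 z := fun z => by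
      have := (hasGradientAt_gradFst P.differentiable_H z y).hasFDerivAt.sub
        (hasGradientAt_gradFst P.differentiable_H z x₂).hasFDerivAt
      rwa [h.gradFst_congr z y x₂, sub_self] at this
    exact is_const_of_fderiv_eq_zero (fun z => (hd z).differentiableAt)
      (fun z => (hd z).fderiv) x₁ x₁'
  have heq : (fun y => P.H (x₁, y)) = fun y => P.H (x₁', y) + (P.H (x₁, x₂) - P.H (x₁', x₂)) :=
    funext fun y => by linarith [hsplit y]
  simp only [gradSnd, gradient, heq, fderiv_add_const]

theorem gradSnd_minimum (P : PHPlant m p) : gradSnd P.H (P.x₁s, P.x₂s) = 0 := by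
  have hmin : IsLocalMin (fun y => P.H (P.x₁s, y)) P.x₂s := .of_forall fun y => by
    by_cases hy : y = P.x₂s
    · simp [hy]
    · exact (P.H_strict_min (P.x₁s, y) (by simpa using hy)).le
  simp [gradSnd, gradient, hmin.fderiv_eq_zero]

end PHPlant

namespace IntegralController

variable {m p : ℕ} (C : IntegralController m p) (P : PHPlant m p)

/-! ### The shifted closed-loop Hamiltonian -/

theorem differentiable_Hc : Differentiable ℝ C.Hc := C.Hc_contDiff.differentiable (by norm_num)

theorem hasGradientAt_Hc (y : Vec p) : HasGradientAt C.Hc (gradient C.Hc y) y :=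
  (C.differentiable_Hc y).hasGradientAt

/-- The gradient of the controller Hamiltonian at the state `w`. -/
noncomputable def gradHc (w : Vec m × Vec p × Vec p) : Vec p :=
  gradient C.Hc (matAct C.Eᵀ w.1 - w.2.2)

theorem hasGradientAt_Hc_comp (x₁ : Vec m) (x₂ ζ : Vec p) :
    HasGradientAt (fun y => C.Hc (matAct C.Eᵀ y - ζ)) (matAct C.E (C.gradHc (x₁, x₂, ζ))) x₁ := by
  have h := (C.hasGradientAt_Hc (matAct C.Eᵀ x₁ - ζ)).comp_matAct_sub
  rwa [Matrix.transpose_transpose] at h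

theorem hclGradientIs_iff (w : Vec m × Vec p × Vec p) (g₁ : Vec m) (g₂ g₃ : Vec p) :
    C.HclGradientIs P w g₁ g₂ g₃ ↔
      gradFst P.H (w.1, w.2.1) + matAct C.E (C.gradHc w) = g₁ ∧
      gradSnd P.H (w.1, w.2.1) = g₂ ∧ -C.gradHc w = g₃ := by
  obtain ⟨x₁, x₂, ζ⟩ := w
  have h1 : HasGradientAt (fun y => C.Hcl P y x₂ ζ)
      (gradFst P.H (x₁, x₂) + matAct C.E (C.gradHc (x₁, x₂, ζ))) x₁ := by
    rw [hasGradientAt_iff_hasFDerivAt, map_add]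
    exact (hasGradientAt_gradFst P.differentiable_H x₁ x₂).hasFDerivAt.add
      (C.hasGradientAt_Hc_comp x₁ x₂ ζ).hasFDerivAt
  have h2 : HasGradientAt (fun y => C.Hcl P x₁ y ζ) (gradSnd P.H (x₁, x₂)) x₂ := by
    rw [hasGradientAt_iff_hasFDerivAt]
    exact (hasGradientAt_gradSnd P.differentiable_H x₁ x₂).hasFDerivAt.add_const _
  have h3 : HasGradientAt (fun y => C.Hcl P x₁ x₂ y) (-C.gradHc (x₁, x₂, ζ)) ζ := by
    have h := (HasFDerivAt.comp ζ (C.hasGradientAt_Hc (matAct C.Eᵀ x₁ - ζ)).hasFDerivAt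
      ((hasFDerivAt_id ζ).const_sub (matAct C.Eᵀ x₁))).const_add (P.H (x₁, x₂))
    rw [hasGradientAt_iff_hasFDerivAt]
    refine h.congr_fderiv ?_
    ext v
    simp [gradHc]
  simp only [HclGradientIs, h1.gradient, h2.gradient, h3.gradient]

/-- The closed-loop Hamiltonian tilted by a linear function, so that its gradient vanishes where
the one of `Hcl` equals `(a, 0, b)`. -/
noncomputable def shiftedHcl (a : Vec m) (b : Vec p) (w : Vec m × Vec p × Vec p) : ℝ :=
  C.Hcl P w.1 w.2.1 w.2.2 - (⟪a, w.1⟫_ℝ + ⟪b, w.2.2⟫_ℝ)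

theorem differentiable_shiftedHcl (a : Vec m) (b : Vec p) :
    Differentiable ℝ (C.shiftedHcl P a b) := by
  have h1 := P.differentiable_H
  have h2 := C.differentiable_Hc
  have h3 : Differentiable ℝ fun w : Vec m × Vec p × Vec p => matAct C.Eᵀ w.1 :=
    (matActL C.Eᵀ).differentiable.comp differentiable_fst
  have h4 : Differentiable ℝ fun w : Vec m × Vec p × Vec p => ⟪a, w.1⟫_ℝ :=
    (innerSL ℝ a).differentiable.comp differentiable_fst
  have h5 : Differentiable ℝ fun w : Vec m × Vec p × Vec p => ⟪b, w.2.2⟫_ℝ :=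
    (innerSL ℝ b).differentiable.comp (differentiable_snd.comp differentiable_snd)
  unfold shiftedHcl Hcl
  fun_prop

theorem fderiv_shiftedHcl (a : Vec m) (b : Vec p) (w v : Vec m × Vec p × Vec p) :
    fderiv ℝ (C.shiftedHcl P a b) w v =
      ⟪gradFst P.H (w.1, w.2.1) + matAct C.E (C.gradHc w) - a, v.1⟫_ℝ +
        ⟪gradSnd P.H (w.1, w.2.1), v.2.1⟫_ℝ + ⟪-C.gradHc w - b, v.2.2⟫_ℝ := by
  let q : Vec m × Vec p × Vec p →L[ℝ] Vec m × Vec p :=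
    (ContinuousLinearMap.fst ℝ _ _).prod
      ((ContinuousLinearMap.fst ℝ _ _).comp (ContinuousLinearMap.snd ℝ _ _))
  let r : Vec m × Vec p × Vec p →L[ℝ] Vec p :=
    (matActL C.Eᵀ).comp (ContinuousLinearMap.fst ℝ _ _) -
      (ContinuousLinearMap.snd ℝ _ _).comp (ContinuousLinearMap.snd ℝ _ _)
  let l : Vec m × Vec p × Vec p →L[ℝ] ℝ :=
    (innerSL ℝ a).comp (ContinuousLinearMap.fst ℝ _ _) +
      (innerSL ℝ b).comp ((ContinuousLinearMap.snd ℝ _ _).comp (ContinuousLinearMap.snd ℝ _ _))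
  have h1 : HasFDerivAt (fun w => P.H (q w)) _ w :=
    HasFDerivAt.comp w (P.differentiable_H (q w)).hasFDerivAt q.hasFDerivAt
  have h2 : HasFDerivAt (fun w => C.Hc (r w)) _ w :=
    HasFDerivAt.comp w (C.hasGradientAt_Hc (r w)).hasFDerivAt r.hasFDerivAt
  have h : HasFDerivAt (C.shiftedHcl P a b) _ w := (h1.add h2).sub l.hasFDerivAt
  rw [h.fderiv]
  have hq : fderiv ℝ P.H (q w) (q v) =
      ⟪gradFst P.H (w.1, w.2.1), v.1⟫_ℝ + ⟪gradSnd P.H (w.1, w.2.1), v.2.1⟫_ℝ :=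
    fderiv_apply_eq_inner_gradFst_add (P.differentiable_H (q w)) (q v)
  have hr : ⟪gradient C.Hc (r w), r v⟫_ℝ =
      ⟪matAct C.E (C.gradHc w), v.1⟫_ℝ - ⟪C.gradHc w, v.2.2⟫_ℝ := by
    have h0 : ⟪gradient C.Hc (r w), r v⟫_ℝ = ⟪C.gradHc w, matAct C.Eᵀ v.1 - v.2.2⟫_ℝ := rfl
    rw [h0, inner_sub_right, inner_matAct_right, Matrix.transpose_transpose]
  have hl : l v = ⟪a, v.1⟫_ℝ + ⟪b, v.2.2⟫_ℝ := rfl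
  simp only [_root_.sub_apply, _root_.add_apply,
    ContinuousLinearMap.comp_apply, InnerProductSpace.toDual_apply_apply, hq, hr, hl,
    inner_sub_left, inner_add_left, inner_neg_left]
  ring

theorem hasFDerivAt_shiftedHcl_zero_iff (a : Vec m) (b : Vec p) (w : Vec m × Vec p × Vec p) :
    HasFDerivAt (C.shiftedHcl P a b) (0 : Vec m × Vec p × Vec p →L[ℝ] ℝ) w ↔ C.HclGradientIs P w a 0 b := by
  rw [hclGradientIs_iff]
  constructor
  · intro h
    have hf : ∀ v, fderiv ℝ (C.shiftedHcl P a b) w v = 0 := fun v => by rw [h.fderiv]; rfl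
    simp only [fderiv_shiftedHcl] at hf
    have h1 := hf (gradFst P.H (w.1, w.2.1) + matAct C.E (C.gradHc w) - a, 0, 0)
    have h2 := hf (0, gradSnd P.H (w.1, w.2.1), 0)
    have h3 := hf (0, 0, -C.gradHc w - b)
    simp only [inner_zero_right, add_zero, zero_add, inner_self_eq_zero] at h1 h2 h3
    exact ⟨sub_eq_zero.1 h1, h2, sub_eq_zero.1 h3⟩
  · rintro ⟨h1, h2, h3⟩
    have h := (C.differentiable_shiftedHcl P a b w).hasFDerivAt
    refine h.congr_fderiv (ContinuousLinearMap.ext fun v => ?_)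
    rw [fderiv_shiftedHcl, h1, h2, h3]
    simp

theorem strictConvexOn_shiftedHcl (hP : StrictConvexOn ℝ Set.univ P.H) (a : Vec m) (b : Vec p) :
    StrictConvexOn ℝ Set.univ (C.shiftedHcl P a b) := by
  refine ⟨convex_univ, ?_⟩
  rintro ⟨x, y, z⟩ - ⟨x', y', z'⟩ - hne s t hs ht hst
  have hr : matAct C.Eᵀ (s • x + t • x') - (s • z + t • z') =
      s • (matAct C.Eᵀ x - z) + t • (matAct C.Eᵀ x' - z') := by
    simp only [← matActL_apply, map_add, map_smul]
    module
  have hl : ⟪a, s • x + t • x'⟫_ℝ + ⟪b, s • z + t • z'⟫_ℝ =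
      s * (⟪a, x⟫_ℝ + ⟪b, z⟫_ℝ) + t * (⟪a, x'⟫_ℝ + ⟪b, z'⟫_ℝ) := by
    simp only [inner_add_right, inner_smul_right]
    ring
  have hH := hP.convexOn.2 (Set.mem_univ (x, y)) (Set.mem_univ (x', y')) hs.le ht.le hst
  have hc := C.Hc_strictConvex.convexOn.2 (Set.mem_univ (matAct C.Eᵀ x - z))
    (Set.mem_univ (matAct C.Eᵀ x' - z')) hs.le ht.le hst
  simp only [shiftedHcl, Hcl, Prod.smul_mk, Prod.mk_add_mk, smul_eq_mul, hr, hl] at hH hc ⊢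
  by_cases hxy : (x, y) = (x', y')
  · -- the states differ in `ζ` only, and strictness comes from `Hc`
    obtain ⟨rfl, rfl⟩ := Prod.mk.inj hxy
    have hz : matAct C.Eᵀ x - z ≠ matAct C.Eᵀ x - z' := by simpa using hne
    have := C.Hc_strictConvex.2 (Set.mem_univ _) (Set.mem_univ _) hz hs ht hst
    simp only [smul_eq_mul] at this
    linarith
  · have := hP.2 (Set.mem_univ (x, y)) (Set.mem_univ (x', y')) hxy hs ht hst
    simp only [Prod.smul_mk, Prod.mk_add_mk, smul_eq_mul] at this
    linarith

/-! ### The closed-loop vector field -/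

theorem contDiff_closedLoop (d₁ : Vec m) (d₂ : Vec p) : ContDiff ℝ 1 (C.closedLoop P d₁ d₂) := by
  let q : Vec m × Vec p × Vec p → Vec m × Vec p := fun w => (w.1, w.2.1)
  have hq : ContDiff ℝ 1 q := by fun_prop
  have hmat : ∀ {k l : ℕ} {A : Vec m × Vec p → Matrix (Fin k) (Fin l) ℝ},
      (∀ i j, ContDiff ℝ ∞ fun x => A x i j) → ∀ i j, ContDiff ℝ 1 fun w => A (q w) i j :=
    fun hA i j => ContDiff.comp (contDiff_infty.1 (hA i j) 1) hq
  have h1 : ContDiff ℝ 1 fun w => gradFst P.H (q w) :=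
    (contDiff_gradFst P.contDiff_two_H).comp hq
  have h2 : ContDiff ℝ 1 fun w => gradSnd P.H (q w) :=
    (contDiff_gradSnd P.contDiff_two_H).comp hq
  have hc : ContDiff ℝ 1 C.gradHc := by
    refine (contDiff_gradient C.Hc_contDiff).comp ?_
    exact ((matActL C.Eᵀ).contDiff.comp contDiff_fst).sub (by fun_prop)
  have hu : ContDiff ℝ 1 fun w : Vec m × Vec p × Vec p => C.input P (q w) w.2.2 := by
    have : (fun w : Vec m × Vec p × Vec p => C.input P (q w) w.2.2) =
        fun w => matAct (P.J₁ (q w) - P.R₁ (q w)) (matActL C.E (C.gradHc w)) :=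
      funext fun w => by
        rw [input, (C.hasGradientAt_Hc_comp w.1 w.2.1 w.2.2).gradient, matActL_apply]
    rw [this]
    exact contDiff_matAct (fun i j => (hmat P.J₁_smooth i j).sub (hmat P.R₁_smooth i j))
      ((matActL C.E).contDiff.comp hc)
  have hf1 : ContDiff ℝ 1 fun w : Vec m × Vec p × Vec p =>
      P.dyn₁ d₁ (q w) (C.input P (q w) w.2.2) :=
    (((contDiff_matAct (fun i j => (hmat P.J₁_smooth i j).sub (hmat P.R₁_smooth i j)) h1).add
      (contDiff_matAct (hmat P.J₁₂_smooth) h2)).add hu).sub contDiff_const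
  have hf2 : ContDiff ℝ 1 fun w : Vec m × Vec p × Vec p => P.dyn₂ d₂ (q w) :=
    ((contDiff_matAct (fun i j => (hmat P.J₁₂_smooth j i).neg) h1).add
      (contDiff_matAct (fun i j => (hmat P.J₂_smooth i j).sub (hmat P.R₂_smooth i j)) h2)).sub
      contDiff_const
  have hf3 : ContDiff ℝ 1 fun w : Vec m × Vec p × Vec p => C.dynζ P (q w) := by
    simp only [dynζ, matAct_mul]
    exact (matActL C.Eᵀ).contDiff.comp (contDiff_matAct (hmat P.J₁₂_smooth) h2)
  exact hf1.prodMk (hf2.prodMk hf3)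

variable {C P} {d₁ : Vec m} {d₂ : Vec p} {J₁ R₁ : Matrix (Fin m) (Fin m) ℝ}
  {J₁₂ : Matrix (Fin m) (Fin p) ℝ}

/-- In terms of the gradient `(e₁, e₂, e₃)` of the shifted Hamiltonian, the closed loop is an
undisturbed port-Hamiltonian system. The vectors `a` and `b` are the required partial gradients of
`Hcl` in `x₁` and `ζ`. -/
theorem closedLoop_eq (hJ₁ : ∀ x, P.J₁ x = J₁) (hR₁ : ∀ x, P.R₁ x = R₁)
    (hJ₁₂ : ∀ x, P.J₁₂ x = J₁₂) {a : Vec m} {b : Vec p} (ha : matAct (J₁ - R₁) a = d₁)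
    (hb : matAct (J₁₂ᵀ * C.E) b = -(matAct J₁₂ᵀ a + d₂)) (w : Vec m × Vec p × Vec p)
    {e₁ : Vec m} {e₂ e₃ : Vec p} (h₁ : gradFst P.H (w.1, w.2.1) + matAct C.E (C.gradHc w) - a = e₁)
    (h₂ : gradSnd P.H (w.1, w.2.1) = e₂) (h₃ : -C.gradHc w - b = e₃) :
    C.closedLoop P d₁ d₂ w = (matAct (J₁ - R₁) e₁ + matAct J₁₂ e₂,
      -matAct J₁₂ᵀ e₁ + matAct (P.J₂ (w.1, w.2.1) - P.R₂ (w.1, w.2.1)) e₂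
        - matAct J₁₂ᵀ (matAct C.E e₃),
      matAct C.Eᵀ (matAct J₁₂ e₂)) := by
  have hd₂ : d₂ = -matAct J₁₂ᵀ (matAct C.E b) - matAct J₁₂ᵀ a := by
    rw [← matAct_mul, hb]
    abel
  have hE : matAct C.E e₃ = -matAct C.E (C.gradHc w) - matAct C.E b := by
    rw [← h₃]
    simp only [← matActL_apply, map_sub, map_neg]
  refine Prod.ext ?_ (Prod.ext ?_ ?_)
  · change P.dyn₁ d₁ (w.1, w.2.1) (C.input P (w.1, w.2.1) w.2.2) = _
    rw [PHPlant.dyn₁, input, (C.hasGradientAt_Hc_comp w.1 w.2.1 w.2.2).gradient, hJ₁, hR₁, hJ₁₂,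
      h₂, ← h₁, ← ha, matAct_vsub, matAct_vadd]
    module
  · change P.dyn₂ d₂ (w.1, w.2.1) = _
    rw [PHPlant.dyn₂, hJ₁₂, h₂, matAct_neg, hE, hd₂, ← h₁]
    simp only [← matActL_apply, map_sub, map_add, map_neg]
    abel
  · change C.dynζ P (w.1, w.2.1) = _
    rw [dynζ, hJ₁₂, h₂, matAct_mul]

/-- The power balance: only the dissipation terms survive. -/
theorem fderiv_shiftedHcl_closedLoop (hJ₁ : ∀ x, P.J₁ x = J₁) (hR₁ : ∀ x, P.R₁ x = R₁)
    (hJ₁₂ : ∀ x, P.J₁₂ x = J₁₂) {a : Vec m} {b : Vec p} (ha : matAct (J₁ - R₁) a = d₁)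
    (hb : matAct (J₁₂ᵀ * C.E) b = -(matAct J₁₂ᵀ a + d₂)) (w : Vec m × Vec p × Vec p)
    {e₁ : Vec m} {e₂ : Vec p} (h₁ : gradFst P.H (w.1, w.2.1) + matAct C.E (C.gradHc w) - a = e₁)
    (h₂ : gradSnd P.H (w.1, w.2.1) = e₂) :
    fderiv ℝ (C.shiftedHcl P a b) w (C.closedLoop P d₁ d₂ w) =
      -⟪e₁, matAct R₁ e₁⟫_ℝ - ⟪e₂, matAct (P.R₂ (w.1, w.2.1)) e₂⟫_ℝ := by
  have hskew₁ : J₁ᵀ = -J₁ := hJ₁ (w.1, w.2.1) ▸ P.J₁_skew _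
  rw [closedLoop_eq hJ₁ hR₁ hJ₁₂ ha hb w h₁ h₂ rfl, fderiv_shiftedHcl, h₁, h₂]
  generalize -C.gradHc w - b = e₃
  have i1 := inner_matAct_self_of_skew hskew₁ e₁
  have i2 := inner_matAct_self_of_skew (P.J₂_skew (w.1, w.2.1)) e₂
  have i3 : ⟪e₂, matAct J₁₂ᵀ e₁⟫_ℝ = ⟪e₁, matAct J₁₂ e₂⟫_ℝ := by
    rw [inner_matAct_right, Matrix.transpose_transpose, real_inner_comm]
  have i4 : ⟪e₂, matAct J₁₂ᵀ (matAct C.E e₃)⟫_ℝ = ⟪e₃, matAct C.Eᵀ (matAct J₁₂ e₂)⟫_ℝ := by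
    rw [inner_matAct_right, inner_matAct_right, Matrix.transpose_transpose, real_inner_comm]
  simp only [inner_add_right, inner_sub_right, inner_neg_right, matAct_sub, i1, i2, i3, i4]
  ring

end IntegralController

/-! ### Stationary solutions -/

theorem eq_of_hasDerivWithinAt_zero {Y : Type*} [NormedAddCommGroup Y] [NormedSpace ℝ Y]
    {f : ℝ → Y} (hf : ∀ t ≥ 0, HasDerivWithinAt f 0 (Set.Ici 0) t) {t : ℝ} (ht : 0 ≤ t) :
    f t = f 0 :=
  constant_of_has_deriv_right_zero
    (fun s hs => (hf s hs.1).continuousWithinAt.mono Set.Icc_subset_Ici_self)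
    (fun s hs => (hf s hs.1).mono (Set.Ici_subset_Ici.2 hs.1)) t ⟨ht, le_rfl⟩

theorem eq_zero_of_hasDerivWithinAt_of_const {Y : Type*} [NormedAddCommGroup Y] [NormedSpace ℝ Y]
    {f : ℝ → Y} {f' : Y} {t : ℝ} (hf : HasDerivWithinAt f f' (Set.Ici 0) t)
    (hc : ∀ s ≥ 0, f s = f 0) (ht : 0 ≤ t) : f' = 0 :=
  (uniqueDiffOn_Ici (0 : ℝ) t ht).eq_deriv _ hf
    ((hasDerivWithinAt_const t (Set.Ici 0) (f 0)).congr hc (hc t ht))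

namespace IntegralController

variable {m p : ℕ} {C : IntegralController m p} {P : PHPlant m p} {d₁ : Vec m} {d₂ : Vec p}
  {J₁ R₁ : Matrix (Fin m) (Fin m) ℝ} {J₁₂ : Matrix (Fin m) (Fin p) ℝ}

/-- A solution without dissipation rests at the critical point of the shifted Hamiltonian: the
vanishing of `e₁` freezes `Eᵀ x₁ - ζ`, hence `x₁`, hence `x₂`, and then the `x₂` equation forces the
last component of the gradient to vanish. -/
theorem hasFDerivAt_shiftedHcl_zero_of_stationary (hcross : P.NoCrossTerms)
    (hP : StrictConvexOn ℝ Set.univ P.H)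
    (hJ₁ : ∀ x, P.J₁ x = J₁) (hR₁ : ∀ x, P.R₁ x = R₁)
    (hJ₁₂ : ∀ x, P.J₁₂ x = J₁₂) (hE : IsUnit (J₁₂ᵀ * C.E)) {a : Vec m} {b : Vec p}
    (ha : matAct (J₁ - R₁) a = d₁) (hb : matAct (J₁₂ᵀ * C.E) b = -(matAct J₁₂ᵀ a + d₂))
    {γ : ℝ → Vec m × Vec p × Vec p} (hγ : SolvesOn (C.closedLoop P d₁ d₂) γ (Set.Ici 0))
    (hstat : ∀ t ≥ 0, fderiv ℝ (C.shiftedHcl P a b) (γ t) (C.closedLoop P d₁ d₂ (γ t)) = 0) :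
    HasFDerivAt (C.shiftedHcl P a b) (0 : Vec m × Vec p × Vec p →L[ℝ] ℝ) (γ 0) := by
  have hRpos : R₁.PosDef := hR₁ ((γ 0).1, (γ 0).2.1) ▸ P.R₁_posDef _
  -- the dissipated power vanishes, and `R₁` is positive definite
  have he₁ : ∀ t ≥ 0, gradFst P.H ((γ t).1, (γ t).2.1) + matAct C.E (C.gradHc (γ t)) - a = 0 := by
    intro t ht
    by_contra hne
    have h1 := inner_matAct_self_pos hRpos hne
    have h2 := inner_matAct_self_nonneg (P.R₂_posSemidef ((γ t).1, (γ t).2.1))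
      (gradSnd P.H ((γ t).1, (γ t).2.1))
    have h3 := hstat t ht
    rw [fderiv_shiftedHcl_closedLoop hJ₁ hR₁ hJ₁₂ ha hb (γ t) rfl rfl] at h3
    linarith
  have hvf : ∀ t ≥ 0, C.closedLoop P d₁ d₂ (γ t) =
      (matAct J₁₂ (gradSnd P.H ((γ t).1, (γ t).2.1)),
        matAct (P.J₂ ((γ t).1, (γ t).2.1) - P.R₂ ((γ t).1, (γ t).2.1))
          (gradSnd P.H ((γ t).1, (γ t).2.1)) -
          matAct J₁₂ᵀ (matAct C.E (-C.gradHc (γ t) - b)),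
        matAct C.Eᵀ (matAct J₁₂ (gradSnd P.H ((γ t).1, (γ t).2.1)))) := by
    intro t ht
    rw [closedLoop_eq hJ₁ hR₁ hJ₁₂ ha hb (γ t) (he₁ t ht) rfl rfl]
    simp [matAct_zero]
  have hd : ∀ t ≥ 0, HasDerivWithinAt γ (C.closedLoop P d₁ d₂ (γ t)) (Set.Ici 0) t := hγ
  have hd₁ : ∀ t ≥ 0, HasDerivWithinAt (fun t => (γ t).1)
      (matAct J₁₂ (gradSnd P.H ((γ t).1, (γ t).2.1))) (Set.Ici 0) t := fun t ht => by
    have h := hd t ht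
    rw [hvf t ht] at h
    exact hasFDerivAt_fst.comp_hasDerivWithinAt t h
  have hd₂ : ∀ t ≥ 0, HasDerivWithinAt (fun t => (γ t).2.1) (C.closedLoop P d₁ d₂ (γ t)).2.1
      (Set.Ici 0) t := fun t ht =>
    (hd t ht).snd.fst
  have hd₃ : ∀ t ≥ 0, HasDerivWithinAt (fun t => (γ t).2.2)
      (matAct C.Eᵀ (matAct J₁₂ (gradSnd P.H ((γ t).1, (γ t).2.1)))) (Set.Ici 0) t := fun t ht => by
    have h := hd t ht
    rw [hvf t ht] at h
    exact hasFDerivAt_snd.comp_hasDerivWithinAt t (hasFDerivAt_snd.comp_hasDerivWithinAt t h)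
  have hν : ∀ t ≥ 0, matAct C.Eᵀ (γ t).1 - (γ t).2.2 = matAct C.Eᵀ (γ 0).1 - (γ 0).2.2 :=
    fun t ht => eq_of_hasDerivWithinAt_zero
      (f := fun t => matAct C.Eᵀ (γ t).1 - (γ t).2.2) (fun s hs => by
        have h := ((matActL C.Eᵀ).hasFDerivAt.comp_hasDerivWithinAt s (hd₁ s hs)).sub (hd₃ s hs)
        rwa [matActL_apply, sub_self] at h) ht
  have hg₁ : ∀ t ≥ 0, gradFst P.H ((γ t).1, (γ 0).2.1) = gradFst P.H ((γ 0).1, (γ 0).2.1) := by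
    intro t ht
    have hc : C.gradHc (γ t) = C.gradHc (γ 0) := congrArg (gradient C.Hc) (hν t ht)
    have h := (he₁ t ht).trans (he₁ 0 le_rfl).symm
    rw [hc] at h
    rw [hcross.gradFst_congr _ _ (γ t).2.1]
    exact add_right_cancel (sub_left_injective h)
  have hx₁ : ∀ t ≥ 0, (γ t).1 = (γ 0).1 := fun t ht => by
    have h := hasGradientAt_gradFst P.differentiable_H (γ t).1 (γ 0).2.1
    rw [hg₁ t ht] at h
    exact (hP.prodMk_right (γ 0).2.1).eq_of_hasGradientAt h
      (hasGradientAt_gradFst P.differentiable_H (γ 0).1 (γ 0).2.1)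
  -- `J₁₂` is injective because `Eᵀ J₁₂` is
  have hJinj : ∀ v : Vec p, matAct J₁₂ v = 0 → v = 0 := fun v hv => by
    have hEt : IsUnit (C.Eᵀ * J₁₂) := by
      simpa using (Matrix.isUnit_transpose (A := J₁₂ᵀ * C.E)).2 hE
    refine matAct_injective_of_isUnit hEt ?_
    rw [matAct_mul, hv, matAct_zero, matAct_zero]
  have he₂ : ∀ t ≥ 0, gradSnd P.H ((γ t).1, (γ t).2.1) = 0 := fun t ht =>
    hJinj _ (eq_zero_of_hasDerivWithinAt_of_const (hd₁ t ht) hx₁ ht)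
  have hx₂ : ∀ t ≥ 0, (γ t).2.1 = (γ 0).2.1 := fun t ht => by
    have h := hasGradientAt_gradSnd P.differentiable_H (γ t).1 (γ t).2.1
    have h0 := hasGradientAt_gradSnd P.differentiable_H (γ 0).1 (γ 0).2.1
    rw [he₂ t ht, hx₁ t ht] at h
    rw [he₂ 0 le_rfl] at h0
    exact (hP.prodMk_left (γ 0).1).eq_of_hasGradientAt h h0
  have he₃ : -C.gradHc (γ 0) - b = 0 := by
    have h := eq_zero_of_hasDerivWithinAt_of_const (hd₂ 0 le_rfl) hx₂ le_rfl
    rw [hvf 0 le_rfl, he₂ 0 le_rfl] at h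
    simp only [matAct_zero, zero_sub, neg_eq_zero, ← matAct_mul] at h
    exact matAct_injective_of_isUnit hE (h.trans (matAct_zero _).symm)
  rw [hasFDerivAt_shiftedHcl_zero_iff, hclGradientIs_iff]
  exact ⟨sub_eq_zero.1 (he₁ 0 le_rfl), he₂ 0 le_rfl, sub_eq_zero.1 he₃⟩

end IntegralController

/-! ### The equilibrium and its stability -/

theorem proposition3 {m p : ℕ} (P : PHPlant m p) (C : IntegralController m p)
    (d₁ : Vec m) (d₂ : Vec p)
    (J₁ R₁ : Matrix (Fin m) (Fin m) ℝ) (J₁₂ : Matrix (Fin m) (Fin p) ℝ)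
    (hrank : P.FullRank)
    (hcross : P.NoCrossTerms)
    (hconv : P.HamiltonianStronglyConvex)
    (hJ₁ : ∀ x, P.J₁ x = J₁) (hR₁ : ∀ x, P.R₁ x = R₁)
    (hJ₁₂ : ∀ x, P.J₁₂ x = J₁₂)
    (hE : IsUnit (J₁₂ᵀ * C.E))
    (hx₁bar : ∃! x₁bar : Vec m, gradFst P.H (x₁bar, P.x₂s) =
      matAct ((1 - C.E * (J₁₂ᵀ * C.E)⁻¹ * J₁₂ᵀ) * (J₁ - R₁)⁻¹) d₁
        - matAct (C.E * (J₁₂ᵀ * C.E)⁻¹) d₂) :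
    ∃ (x₁bar : Vec m) (ζbar : Vec p),
      gradFst P.H (x₁bar, P.x₂s) =
        matAct ((1 - C.E * (J₁₂ᵀ * C.E)⁻¹ * J₁₂ᵀ) * (J₁ - R₁)⁻¹) d₁
          - matAct (C.E * (J₁₂ᵀ * C.E)⁻¹) d₂ ∧
      (∀ w : Vec m × Vec p × Vec p,
        C.HclGradientIs P w
          (matAct (J₁ - R₁)⁻¹ d₁)
          0
          (-matAct (J₁₂ᵀ * C.E)⁻¹ (matAct J₁₂ᵀ (matAct (J₁ - R₁)⁻¹ d₁) + d₂)) ↔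
        w = (x₁bar, P.x₂s, ζbar)) ∧
      IsGloballyAsymptoticallyStable (C.closedLoop P d₁ d₂) (x₁bar, P.x₂s, ζbar) := by
  obtain ⟨x₁bar, hx₁, -⟩ := hx₁bar
  have hP : StrictConvexOn ℝ Set.univ P.H := hconv.strictConvexOn
  have hskew : J₁ᵀ = -J₁ := hJ₁ (x₁bar, P.x₂s) ▸ P.J₁_skew _
  have hRpos : R₁.PosDef := hR₁ (x₁bar, P.x₂s) ▸ P.R₁_posDef _
  have ha := matAct_matAct_inv (isUnit_skew_sub_posDef hskew hRpos) d₁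
  have hc := matAct_matAct_inv hE (matAct J₁₂ᵀ (matAct (J₁ - R₁)⁻¹ d₁) + d₂)
  have hx₁' : gradFst P.H (x₁bar, P.x₂s) = matAct (J₁ - R₁)⁻¹ d₁ - matAct C.E
      (matAct (J₁₂ᵀ * C.E)⁻¹ (matAct J₁₂ᵀ (matAct (J₁ - R₁)⁻¹ d₁) + d₂)) := by
    rw [hx₁]
    simp only [matAct_mul, matAct_sub, matAct_one, matAct_vadd]
    abel
  set a := matAct (J₁ - R₁)⁻¹ d₁
  set c := matAct (J₁₂ᵀ * C.E)⁻¹ (matAct J₁₂ᵀ a + d₂)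
  have hb : matAct (J₁₂ᵀ * C.E) (-c) = -(matAct J₁₂ᵀ a + d₂) := by
    rw [← hc]
    exact (matActL (J₁₂ᵀ * C.E)).map_neg c
  obtain ⟨ν, hν⟩ := C.Hc_grad_bijective.2 c
  set e : Vec m × Vec p × Vec p := (x₁bar, P.x₂s, matAct C.Eᵀ x₁bar - ν)
  have hge : C.gradHc e = c := by
    rw [← hν]
    exact congrArg (gradient C.Hc) (sub_sub_cancel _ _)
  have he : C.HclGradientIs P e a 0 (-c) := by
    rw [IntegralController.hclGradientIs_iff, hge]
    refine ⟨?_, ?_, rfl⟩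
    · change gradFst P.H (x₁bar, P.x₂s) + matAct C.E c = a
      rw [hx₁', sub_add_cancel]
    · change gradSnd P.H (x₁bar, P.x₂s) = 0
      rw [hcross.gradSnd_congr x₁bar P.x₁s, P.gradSnd_minimum]
  have hconvW := C.strictConvexOn_shiftedHcl P hP a (-c)
  have hdiffW := C.differentiable_shiftedHcl P a (-c)
  have heW := (C.hasFDerivAt_shiftedHcl_zero_iff P a (-c) e).2 he
  have hminW : ∀ w, w ≠ e → C.shiftedHcl P a (-c) e < C.shiftedHcl P a (-c) w := fun w hw => by
    simpa using hconvW.add_fderiv_lt heW hw.symm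
  refine ⟨x₁bar, matAct C.Eᵀ x₁bar - ν, hx₁, fun w => ⟨fun h => ?_, fun h => h ▸ he⟩, ?_⟩
  · exact hconvW.eq_of_hasFDerivAt ((C.hasFDerivAt_shiftedHcl_zero_iff P a (-c) w).2 h) heW
  · refine .of_lyapunov (C.contDiff_closedLoop P d₁ d₂) hdiffW (fun w => ?_)
      (hconvW.convexOn.isBounded_sublevel hdiffW.continuous hminW) hminW ?_ fun γ hγ hstat => ?_
    · rw [IntegralController.fderiv_shiftedHcl_closedLoop hJ₁ hR₁ hJ₁₂ ha hb w rfl rfl]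
      have h1 := inner_matAct_self_nonneg hRpos.posSemidef
        (gradFst P.H (w.1, w.2.1) + matAct C.E (C.gradHc w) - a)
      have h2 := inner_matAct_self_nonneg (P.R₂_posSemidef (w.1, w.2.1))
        (gradSnd P.H (w.1, w.2.1))
      linarith
    · obtain ⟨h1, h2, h3⟩ := (C.hclGradientIs_iff P e a 0 (-c)).1 he
      rw [IntegralController.closedLoop_eq hJ₁ hR₁ hJ₁₂ ha hb e (sub_eq_zero.2 h1) h2
        (sub_eq_zero.2 h3)]
      simp [matAct_zero]
    · exact hconvW.eq_of_hasFDerivAt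
        (IntegralController.hasFDerivAt_shiftedHcl_zero_of_stationary hcross hP hJ₁ hR₁ hJ₁₂ hE
          ha hb hγ hstat) heW
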